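/- Let $\mathrm{W}(\mathbf{H}_4)$ be the Coxeter group of type $\mathbf{H}_4$ (a finite group), let $\mathfrak{A}_8$ be the alternating group on $8$ letters, and let $\mathrm{A}_4\subset\mathfrak{S}_4$ be the Klein group, consisting of the identity and the three double transpositions. Let $\mathrm{A}_4\ltimes\{\pm1\}^4$ be the semidirect product in which $\mathrm{A}_4$ acts on $\{\pm1\}^4$ via its inclusion in $\mathfrak{S}_4$, that is, by permuting the four factors. Let $\mathrm{Q}_8=\{\pm1,\pm\mathbf{i},\pm\mathbf{j},\pm\mathbf{k}\}$ be the quaternion group, and let $\mathfrak{S}_2\ltimes(\mathrm{Q}_8\times\mathrm{Q}_8)$ be the semidirect product in which $\mathfrak{S}_2$ acts by permuting the two factors. Then: 1. the quotient group $(\mathfrak{S}_2\ltimes(\mathrm{Q}_8\times\mathrm{Q}_8))/\langle(-1,-1)\rangle$ is isomorphic to $\mathrm{A}_4\ltimes\{\pm1\}^4$; 2. every $2$-Sylow subgroup of $\mathrm{W}(\mathbf{H}_4)$ and every $2$-Sylow subgroup of $\mathfrak{A}_8$ are isomorphic to each other, and both are isomorphic to $\mathrm{A}_4\ltimes\{\pm1\}^4$.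 -/

import Mathlib

open scoped Quaternion

noncomputable section

namespace Quat

/-- The quaternion `i`. -/
def i : ℍ[ℝ] := ⟨0, 1, 0, 0⟩

/-- The quaternion `j`. -/
def j : ℍ[ℝ] := ⟨0, 0, 1, 0⟩

/-- The quaternion `k`. -/
def k : ℍ[ℝ] := ⟨0, 0, 0, 1⟩

theorem i_mul_i : i * i = -1 := by ext <;> simp <;> simp [i]

theorem j_mul_j : j * j = -1 := by ext <;> simp <;> simp [j]

theorem k_mul_k : k * k = -1 := by ext <;> simp <;> simp [k]

theorem i_mul_j : i * j = k := by ext <;> simp <;> simp [i, j, k]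

theorem j_mul_i : j * i = -k := by ext <;> simp <;> simp [i, j, k]

theorem j_mul_k : j * k = i := by ext <;> simp <;> simp [i, j, k]

theorem k_mul_j : k * j = -i := by ext <;> simp <;> simp [i, j, k]

theorem k_mul_i : k * i = j := by ext <;> simp <;> simp [i, j, k]

theorem i_mul_k : i * k = -j := by ext <;> simp <;> simp [i, j, k]

end Quat

/-- The quaternion group `{±1, ±i, ±j, ±k}`, as a subgroup of the multiplicative group of the
real quaternions. -/
def Q8 : Subgroup ℍ[ℝ]ˣ where
  carrier := {x | (x : ℍ[ℝ]) = 1 ∨ (x : ℍ[ℝ]) = -1 ∨ (x : ℍ[ℝ]) = Quat.i ∨ (x : ℍ[ℝ]) = -Quat.i ∨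
    (x : ℍ[ℝ]) = Quat.j ∨ (x : ℍ[ℝ]) = -Quat.j ∨ (x : ℍ[ℝ]) = Quat.k ∨ (x : ℍ[ℝ]) = -Quat.k}
  one_mem' := Or.inl rfl
  mul_mem' := by
    rintro a b (h | h | h | h | h | h | h | h) (h' | h' | h' | h' | h' | h' | h' | h') <;>
    simp only [Set.mem_ofPred_eq, Units.val_mul, h, h'] <;>
    simp [Quat.i_mul_i, Quat.j_mul_j, Quat.k_mul_k, Quat.i_mul_j, Quat.j_mul_i,
      Quat.j_mul_k, Quat.k_mul_j, Quat.k_mul_i, Quat.i_mul_k]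
  inv_mem' := by
    rintro a (h | h | h | h | h | h | h | h)
    · exact Or.inl (Units.inv_eq_of_mul_eq_one_right (by simp [h]))
    · exact Or.inr (Or.inl (Units.inv_eq_of_mul_eq_one_right (by simp [h])))
    · exact Or.inr (Or.inr (Or.inr (Or.inl
        (Units.inv_eq_of_mul_eq_one_right (by simp [h, Quat.i_mul_i])))))
    · exact Or.inr (Or.inr (Or.inl
        (Units.inv_eq_of_mul_eq_one_right (by simp [h, Quat.i_mul_i]))))
    · exact Or.inr (Or.inr (Or.inr (Or.inr (Or.inr (Or.inl
        (Units.inv_eq_of_mul_eq_one_right (by simp [h, Quat.j_mul_j])))))))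
    · exact Or.inr (Or.inr (Or.inr (Or.inr (Or.inl
        (Units.inv_eq_of_mul_eq_one_right (by simp [h, Quat.j_mul_j]))))))
    · exact Or.inr (Or.inr (Or.inr (Or.inr (Or.inr (Or.inr (Or.inr
        (Units.inv_eq_of_mul_eq_one_right (by simp [h, Quat.k_mul_k]))))))))
    · exact Or.inr (Or.inr (Or.inr (Or.inr (Or.inr (Or.inr (Or.inl
        (Units.inv_eq_of_mul_eq_one_right (by simp [h, Quat.k_mul_k]))))))))

/-- The element `-1` of `Q8`. -/
def Q8.negOne : Q8 := ⟨-1, Or.inr (Or.inl rfl)⟩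

/-- The semidirect product `𝔖₂ ⋉ (Q₈ × Q₈)`, where `𝔖₂` permutes the two factors
(`mulAutArrow σ f = f ∘ σ⁻¹`). -/
abbrev Q8Wreath : Type :=
  (Fin 2 → Q8) ⋊[(mulAutArrow : Equiv.Perm (Fin 2) →* MulAut (Fin 2 → Q8))] Equiv.Perm (Fin 2)

/-- The subgroup `⟨(-1, -1)⟩` of `𝔖₂ ⋉ (Q₈ × Q₈)`. -/
def Q8Wreath.negOneNegOne : Subgroup Q8Wreath :=
  Subgroup.zpowers (SemidirectProduct.inl fun _ => Q8.negOne)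

instance : Q8Wreath.negOneNegOne.Normal := by
  have hc : (SemidirectProduct.inl fun _ => Q8.negOne : Q8Wreath) ∈ Subgroup.center Q8Wreath := by
    rw [Subgroup.mem_center_iff]
    intro g
    refine SemidirectProduct.ext ?_ ?_
    · funext i
      apply Subtype.ext
      apply Units.ext
      change ((g.left i : ℍ[ℝ]ˣ) : ℍ[ℝ]) * (-1) = (-1) * ((g.left i : ℍ[ℝ]ˣ) : ℍ[ℝ])
      simp
    · simp
  refine ⟨fun n hn g => ?_⟩
  have hn' : n ∈ Subgroup.center Q8Wreath := (Subgroup.zpowers_le.2 hc) hn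
  rw [Subgroup.mem_center_iff.1 hn' g, mul_inv_cancel_right]
  exact hn

/-- The action of the Klein group (the subgroup of `𝔖₄` formed by the identity and the three
double transpositions) on `{±1}⁴`, through its inclusion in `𝔖₄` and the permutation of the
four factors. -/
def kleinAction : alternatingGroup.kleinFour (Fin 4) →* MulAut (Fin 4 → ℤˣ) :=
  (mulAutArrow : Equiv.Perm (Fin 4) →* MulAut (Fin 4 → ℤˣ)).comp
    ((alternatingGroup (Fin 4)).subtype.comp (alternatingGroup.kleinFour (Fin 4)).subtype)

/-- The semidirect product of the Klein group with `{±1}⁴`. -/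
abbrev KleinSemidirect : Type :=
  (Fin 4 → ℤˣ) ⋊[kleinAction] alternatingGroup.kleinFour (Fin 4)

end

/-!
A `2`-group `K` is a Sylow `2`-subgroup of `G` as soon as it acts faithfully by permutations that
are also induced by a faithful action of `G`, and `|G| / |K|` is odd. For `K = A₄ ⋉ {±1}⁴`, of
order `2⁶`, acting by signed permutations of coordinates, this applies twice.

* `K` permutes the eight vectors `± e₀ ± e₁`, `± e₂ ± e₃` of `𝔽₃⁴` faithfully and evenly, and
  `8! / 2 = 2⁶ · 315`.
* Reducing the geometric representation of `W(H₄)` modulo `√5` gives an action on `𝔽₅⁴`. It is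
  transitive on the roots, the vectors of norm one, so it realizes the reflection in every one of
  them; products of these include generators of the image of `K`. That the action is faithful and
  that `|W(H₄)| = 120 · 12 · 5 · 2 = 2⁶ · 225` follows from the chain of parabolic subgroups
  `⟨s_k, …, s₃⟩`: in each of them the stabilizer of a suitable vector is the next one.

The group `𝔖₂ ⋉ (Q₈ × Q₈)` acts on the quaternions by `x ↦ a x b⁻¹` and by conjugation, with
kernel `⟨(-1, -1)⟩`. In the coordinates of the quaternions, these are exactly the signed
permutations in the image of `K`.
-/

open Equiv MulAction

section Sylow

variable {p : ℕ} [Fact p.Prime] {G H K : Type*} [Group G] [Finite G] [Group H] [Group K]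

theorem nonempty_sylow_mulEquiv_of_range_le {ρ : G →* H} {f : K →* H}
    (hρ : Function.Injective ρ) (hf : Function.Injective f) (hle : f.range ≤ ρ.range)
    (hK : IsPGroup p K) {m : ℕ} (hG : Nat.card G = Nat.card K * m) (hm : ¬ p ∣ m)
    (P : Sylow p G) : Nonempty (P ≃* K) := by
  let S := f.range.comap ρ
  let e : S ≃* K := (S.equivMapOfInjective ρ hρ).trans <|
    (MulEquiv.subgroupCongr (Subgroup.map_comap_eq_self hle)).trans (MonoidHom.ofInjective hf).symm
  have hindex : S.index = m := by
    rw [← Nat.card_congr e.toEquiv, ← S.card_mul_index] at hG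
    exact Nat.eq_of_mul_eq_mul_left Nat.card_pos hG
  exact ⟨(P.equiv ((hK.of_equiv e.symm).toSylow (hindex ▸ hm))).trans e⟩

end Sylow

/-! ### The group `A₄ ⋉ {±1}⁴` -/

/-- The permutation in the Klein group that maps `0` to `j`. -/
def doubleTransposition : Fin 4 → Perm (Fin 4) :=
  ![1, swap 0 1 * swap 2 3, swap 0 2 * swap 1 3, swap 0 3 * swap 1 2]

theorem doubleTransposition_mem_alternatingGroup (j : Fin 4) :
    doubleTransposition j ∈ alternatingGroup (Fin 4) := by
  rw [Perm.mem_alternatingGroup]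
  revert j; decide

theorem mk_doubleTransposition_mem_kleinFour (j : Fin 4) :
    ⟨doubleTransposition j, doubleTransposition_mem_alternatingGroup j⟩ ∈
      alternatingGroup.kleinFour (Fin 4) := by
  have hcycle : doubleTransposition j = 1 ∨ (doubleTransposition j).cycleType = {2, 2} := by
    revert j; decide
  rw [← SetLike.mem_coe, alternatingGroup.coe_kleinFour_of_card_eq_four (by simp)]
  exact hcycle.imp_left Subtype.ext

/-- The permutation `doubleTransposition j`, as an element of the Klein group. -/
def klein (j : Fin 4) : alternatingGroup.kleinFour (Fin 4) :=
  ⟨_, mk_doubleTransposition_mem_kleinFour j⟩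

theorem klein_surjective : Function.Surjective klein := fun σ ↦ by
  have hsq : (σ.1 : Perm (Fin 4)) * σ.1 = 1 := by
    have h := Monoid.pow_exponent_eq_one σ
    rw [alternatingGroup.exponent_kleinFour_of_card_eq_four (by simp), pow_two] at h
    exact congrArg (fun τ : alternatingGroup.kleinFour (Fin 4) ↦ (τ.1 : Perm (Fin 4))) h
  have hall : ∀ τ : Perm (Fin 4), Perm.sign τ = 1 → τ * τ = 1 → ∃ j, doubleTransposition j = τ := by
    decide
  obtain ⟨j, hj⟩ := hall _ (Perm.mem_alternatingGroup.1 σ.1.2) hsq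
  exact ⟨j, Subtype.ext (Subtype.ext hj)⟩

theorem klein_one_mul_klein_two : klein 1 * klein 2 = klein 3 :=
  Subtype.ext (Subtype.ext (by decide : doubleTransposition 1 * doubleTransposition 2 = _))

theorem kleinAction_klein_mulSingle_zero (j : Fin 4) (a : ℤˣ) :
    kleinAction (klein j) (Pi.mulSingle 0 a) = Pi.mulSingle j a := by
  change (fun i ↦ (Pi.mulSingle 0 a : Fin 4 → ℤˣ) ((doubleTransposition j)⁻¹ i)) = _
  revert j a; decide

namespace KleinSemidirect

theorem card : Nat.card KleinSemidirect = 2 ^ 6 := by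
  rw [SemidirectProduct.card, alternatingGroup.kleinFour_card_of_card_eq_four (by simp)]
  simp

theorem isPGroup : IsPGroup 2 KleinSemidirect := .of_card card

/-- The change of sign of one coordinate. -/
def signChange (i : Fin 4) : KleinSemidirect := SemidirectProduct.inl (Pi.mulSingle i (-1))

theorem conj_signChange_zero (ε : Fin 4 → ℤˣ) (j : Fin 4) :
    (⟨ε, klein j⟩ * signChange 0 * ⟨ε, klein j⟩⁻¹ : KleinSemidirect) = signChange j := by
  rw [SemidirectProduct.mk_eq_inl_mul_inr, mul_inv_rev, signChange, signChange,
    ← kleinAction_klein_mulSingle_zero j]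
  calc SemidirectProduct.inl ε * SemidirectProduct.inr (klein j) *
        SemidirectProduct.inl (Pi.mulSingle 0 (-1)) *
        ((SemidirectProduct.inr (klein j))⁻¹ * (SemidirectProduct.inl ε)⁻¹)
      = SemidirectProduct.inl ε *
          SemidirectProduct.inl (kleinAction (klein j) (Pi.mulSingle 0 (-1))) *
          (SemidirectProduct.inl ε)⁻¹ := by
        rw [SemidirectProduct.inl_aut, map_inv]
        group
    _ = SemidirectProduct.inl (kleinAction (klein j) (Pi.mulSingle 0 (-1))) := by
        rw [← map_inv, ← map_mul, ← map_mul, mul_comm ε, mul_inv_cancel_right]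

theorem inl_mem {S : Subgroup KleinSemidirect} (hsign : ∀ i, signChange i ∈ S)
    (ε : Fin 4 → ℤˣ) : SemidirectProduct.inl ε ∈ S := by
  rw [← Subgroup.mem_comap, ← Finset.univ_prod_mulSingle ε]
  refine Subgroup.prod_mem _ fun i _ ↦ ?_
  obtain h | h := Int.units_eq_one_or (ε i)
  · rw [h, Pi.mulSingle_one]
    exact one_mem _
  · rw [h]
    exact hsign i

/-- Conjugation by lifts of the Klein group moves the sign change of the first coordinate to all
others. -/
theorem eq_top_of_mem {S : Subgroup KleinSemidirect} {ε₁ ε₂ : Fin 4 → ℤˣ}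
    (hsign : signChange 0 ∈ S) (h₁ : ⟨ε₁, klein 1⟩ ∈ S) (h₂ : ⟨ε₂, klein 2⟩ ∈ S) : S = ⊤ := by
  have hklein (j : Fin 4) : ∃ ε, (⟨ε, klein j⟩ : KleinSemidirect) ∈ S := by
    fin_cases j
    · exact ⟨_, S.one_mem⟩
    · exact ⟨_, h₁⟩
    · exact ⟨_, h₂⟩
    · refine ⟨(⟨ε₁, klein 1⟩ * ⟨ε₂, klein 2⟩ : KleinSemidirect).left, ?_⟩
      change (⟨_, klein 3⟩ : KleinSemidirect) ∈ S
      rw [← klein_one_mul_klein_two]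
      exact S.mul_mem h₁ h₂
  have hinl := inl_mem fun i ↦ by
    obtain ⟨ε, hε⟩ := hklein i
    exact conj_signChange_zero ε i ▸ S.mul_mem (S.mul_mem hε hsign) (S.inv_mem hε)
  refine (Subgroup.eq_top_iff' S).2 fun ⟨δ, σ⟩ ↦ ?_
  obtain ⟨j, rfl⟩ := klein_surjective σ
  obtain ⟨ε, hε⟩ := hklein j
  rw [SemidirectProduct.mk_eq_inl_mul_inr] at hε ⊢
  exact S.mul_mem (hinl δ) ((S.mul_mem_cancel_left (hinl ε)).1 hε)

section Action

variable {R : Type*} [Ring R]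

/-- The action on `R⁴` by signed permutations of the coordinates. -/
instance : MulAction KleinSemidirect (Fin 4 → R) where
  smul k x i := k.left i • x (k.right.1.1⁻¹ i)
  one_smul x := by funext i; exact one_smul ℤˣ _
  mul_smul k l x := by
    funext i
    change (k.left i * l.left (k.right.1.1⁻¹ i)) • x _ = k.left i • l.left _ • x _
    rw [mul_smul]; rfl

theorem smul_apply (k : KleinSemidirect) (x : Fin 4 → R) (i : Fin 4) :
    (k • x) i = k.left i • x (k.right.1.1⁻¹ i) := rfl

theorem signChange_zero_smul (x : Fin 4 → R) : signChange 0 • x = ![-x 0, x 1, x 2, x 3] := by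
  ext i; fin_cases i <;> simp [smul_apply, signChange]

theorem mk_klein_zero_smul (ε : Fin 4 → ℤˣ) (x : Fin 4 → R) :
    (⟨ε, klein 0⟩ : KleinSemidirect) • x = ![ε 0 • x 0, ε 1 • x 1, ε 2 • x 2, ε 3 • x 3] := by
  ext i; fin_cases i <;> rfl

theorem mk_klein_one_smul (ε : Fin 4 → ℤˣ) (x : Fin 4 → R) :
    (⟨ε, klein 1⟩ : KleinSemidirect) • x = ![ε 0 • x 1, ε 1 • x 0, ε 2 • x 3, ε 3 • x 2] := by
  ext i; fin_cases i <;> rfl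

theorem mk_klein_two_smul (ε : Fin 4 → ℤˣ) (x : Fin 4 → R) :
    (⟨ε, klein 2⟩ : KleinSemidirect) • x = ![ε 0 • x 2, ε 1 • x 3, ε 2 • x 0, ε 3 • x 1] := by
  ext i; fin_cases i <;> rfl

theorem range_toPermHom_le {S : Subgroup (Perm (Fin 4 → R))} {ε₁ ε₂ : Fin 4 → ℤˣ}
    (hsign : toPermHom KleinSemidirect _ (signChange 0) ∈ S)
    (h₁ : toPermHom KleinSemidirect _ ⟨ε₁, klein 1⟩ ∈ S)
    (h₂ : toPermHom KleinSemidirect _ ⟨ε₂, klein 2⟩ ∈ S) :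
    (toPermHom KleinSemidirect (Fin 4 → R)).range ≤ S := by
  rw [MonoidHom.range_eq_map, Subgroup.map_le_iff_le_comap, top_le_iff]
  exact eq_top_of_mem hsign h₁ h₂

theorem faithfulSMul (h : (1 : R) ≠ -1) : FaithfulSMul KleinSemidirect (Fin 4 → R) := by
  have h₀ : (1 : R) ≠ 0 := fun h₀ ↦ h (by rw [h₀, neg_zero])
  refine faithfulSMul_iff.2 fun ⟨ε, σ⟩ hk ↦ ?_
  have hε : ε = 1 := by
    ext1 i
    refine (Int.units_eq_one_or (ε i)).resolve_right fun hi ↦ h ?_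
    simpa [smul_apply, hi] using (congrFun (hk 1) i).symm
  subst hε
  obtain ⟨j, rfl⟩ := klein_surjective σ
  have hj : (doubleTransposition j)⁻¹ 0 = 0 := by
    simpa [smul_apply, klein, Pi.single_apply, h₀.symm] using congrFun (hk (Pi.single 0 1)) 0
  obtain rfl : j = 0 := by clear hk; decide +revert
  rfl

end Action
end KleinSemidirect

/-! ### The alternating group on eight letters -/

namespace KleinSemidirect

/-- The eight vectors `± e₀ ± e₁`, `± e₂ ± e₃` of `𝔽₃⁴`, stable under `KleinSemidirect`. -/
def eightVectors : SubMulAction KleinSemidirect (Fin 4 → ZMod 3) where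
  carrier := {x | x 0 ^ 2 = x 1 ^ 2 ∧ x 2 ^ 2 = x 3 ^ 2 ∧ x 0 ^ 2 ≠ x 2 ^ 2}
  smul_mem' := by
    rintro ⟨ε, σ⟩ x hx
    obtain ⟨j, rfl⟩ := klein_surjective σ
    simp only [Set.mem_ofPred_eq, smul_apply, smul_pow, Int.units_sq, one_smul] at hx ⊢
    obtain ⟨h₀₁, h₂₃, h₀₂⟩ := hx
    fin_cases j <;> simp [klein, doubleTransposition, swap_apply_def] <;> grind

instance : DecidablePred (· ∈ eightVectors) := fun x ↦
  inferInstanceAs (Decidable (x 0 ^ 2 = x 1 ^ 2 ∧ x 2 ^ 2 = x 3 ^ 2 ∧ x 0 ^ 2 ≠ x 2 ^ 2))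

theorem card_eightVectors : Fintype.card eightVectors = 8 := by decide +kernel

theorem range_toPermHom_eightVectors_le :
    (toPermHom KleinSemidirect eightVectors).range ≤ alternatingGroup eightVectors := by
  rw [MonoidHom.range_eq_map, Subgroup.map_le_iff_le_comap, top_le_iff]
  apply eq_top_of_mem (ε₁ := 1) (ε₂ := 1) <;>
    rw [Subgroup.mem_comap, Perm.mem_alternatingGroup]
  all_goals decide +kernel

theorem faithfulSMul_eightVectors : FaithfulSMul KleinSemidirect eightVectors := by
  have hall : ∀ (ε : Fin 4 → ℤˣ) (j : Fin 4),
      (∀ x : eightVectors, (⟨ε, klein j⟩ : KleinSemidirect) • x = x) → ε = 1 ∧ j = 0 := by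
    decide +kernel
  refine faithfulSMul_iff.2 fun ⟨ε, σ⟩ hk ↦ ?_
  obtain ⟨j, rfl⟩ := klein_surjective σ
  obtain ⟨rfl, rfl⟩ := hall ε j hk
  rfl

end KleinSemidirect

theorem nonempty_sylow_alternatingGroup_mulEquiv {α : Type*} [Fintype α] [DecidableEq α]
    (hα : Fintype.card α = 8) (P : Sylow 2 (alternatingGroup α)) :
    Nonempty (P ≃* KleinSemidirect) := by
  let e : α ≃ KleinSemidirect.eightVectors :=
    Fintype.equivOfCardEq (hα.trans KleinSemidirect.card_eightVectors.symm)
  have := KleinSemidirect.faithfulSMul_eightVectors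
  have : Nontrivial α := Fintype.one_lt_card_iff_nontrivial.1 (by omega)
  refine nonempty_sylow_mulEquiv_of_range_le (m := 315)
    (ρ := (alternatingGroup _).subtype.comp e.altCongrHom.toMonoidHom)
    (f := toPermHom KleinSemidirect KleinSemidirect.eightVectors)
    ((alternatingGroup _).subtype_injective.comp e.altCongrHom.injective) toPerm_injective ?_
    KleinSemidirect.isPGroup ?_ (by decide) P
  · intro τ hτ
    let τ' : alternatingGroup _ := ⟨τ, KleinSemidirect.range_toPermHom_eightVectors_le hτ⟩
    exact ⟨e.altCongrHom.symm τ', congrArg Subtype.val (e.altCongrHom.apply_symm_apply τ')⟩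
  · rw [nat_card_alternatingGroup, KleinSemidirect.card, Nat.card_eq_fintype_card, hα]
    decide

/-! ### Orbits of standard parabolic subgroups -/

section CoxeterOrbit

variable {B W X : Type*} [Group W] {M : CoxeterMatrix B} (cs : CoxeterSystem M W)
  [MulAction W X]

/-- A criterion for `Y` to be the orbit of `x₀` under the group generated by the simple reflections
in `J`, with as small a stabilizer as the simple reflections fixing `x₀` permit. Consider `Y` as a
graph with an edge from `x` to `s_j x` for `j ∈ J`. The edges within a level of `rank` have to be
loops, every point other than `x₀` needs an edge leading to lower rank, and, for any such edge from
`x` to `s_i x` and any other edge from `x` to some `s_j x` that does not lead to higher rank, the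
walk `x, s_i x, s_j s_i x, s_i s_j s_i x, …` to `s_j x` has to stay below the rank of `x`, apart
from its ends. -/
structure IsOrbitRank (J : Set B) (x₀ : X) (Y : Set X) (rank : X → ℕ) : Prop where
  ne_zero : ∀ i ∈ J, ∀ j ∈ J, M i j ≠ 0
  mem_base : x₀ ∈ Y
  rank_base : rank x₀ = 0
  smul_mem : ∀ j ∈ J, ∀ x ∈ Y, cs.simple j • x ∈ Y
  smul_eq : ∀ j ∈ J, ∀ x ∈ Y, rank (cs.simple j • x) = rank x → cs.simple j • x = x
  exists_lt : ∀ x ∈ Y, x ≠ x₀ → ∃ i ∈ J, rank (cs.simple i • x) < rank x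
  peak : ∀ i ∈ J, ∀ j ∈ J, i ≠ j → ∀ x ∈ Y, rank (cs.simple i • x) < rank x →
    rank (cs.simple j • x) ≤ rank x → ∀ k, k < M i j - 1 →
      rank (cs.simple i • (cs.simple j • cs.simple i • ·)^[k] x) < rank x ∧
      rank ((cs.simple j • cs.simple i • ·)^[k + 1] x) < rank x

/-- The standard parabolic subgroup generated by the simple reflections in `J`. -/
def parabolic (J : Set B) : Subgroup W := .closure (cs.simple '' J)

variable {cs}

theorem simple_mul_pow_sub_one {i j : B} (hM : M i j ≠ 0) :
    cs.simple i * (cs.simple j * cs.simple i) ^ (M i j - 1) = cs.simple j := by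
  have h : cs.simple j * (cs.simple i * (cs.simple j * cs.simple i) ^ (M i j - 1)) = 1 := by
    rw [← mul_assoc, mul_pow_sub_one hM, ← M.symmetric j i, cs.simple_mul_simple_pow]
  rw [← mul_eq_one_iff_inv_eq.1 h, cs.inv_simple]

theorem simple_smul_iterate {i j : B} (hM : M i j ≠ 0) (x : X) :
    cs.simple i • (cs.simple j • cs.simple i • ·)^[M i j - 1] x = cs.simple j • x := by
  simp only [← mul_smul, smul_iterate, simple_mul_pow_sub_one hM]

theorem map_simple_smul_of_smul {Z : Type*} [MulAction W Z] {c : X → Z} {j : B} {x : X}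
    (hx : c (cs.simple j • cs.simple j • x) = cs.simple j • c (cs.simple j • x)) :
    c (cs.simple j • x) = cs.simple j • c x := by
  rw [smul_smul, cs.simple_mul_simple_self, one_smul] at hx
  rw [hx, smul_smul, cs.simple_mul_simple_self, one_smul]

theorem simple_mem_parabolic {J : Set B} {j : B} (hj : j ∈ J) : cs.simple j ∈ parabolic cs J :=
  Subgroup.subset_closure ⟨j, hj, rfl⟩

theorem parabolic_mono {J K : Set B} (h : J ⊆ K) : parabolic cs J ≤ parabolic cs K :=
  Subgroup.closure_mono (Set.image_mono h)

@[elab_as_elim]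
theorem parabolic_induction {J : Set B} {p : ∀ g, g ∈ parabolic cs J → Prop}
    (one : p 1 (one_mem _))
    (mul : ∀ j (hj : j ∈ J) g (hg : g ∈ parabolic cs J), p g hg →
      p (cs.simple j * g) (mul_mem (simple_mem_parabolic hj) hg))
    {g : W} (hg : g ∈ parabolic cs J) : p g hg := by
  change g ∈ Subgroup.closure _ at hg
  induction hg using Subgroup.closure_induction_left with
  | one => exact one
  | mul_left _ hs g hg ih =>
    obtain ⟨j, hj, rfl⟩ := hs
    exact mul j hj g hg ih
  | inv_mul_cancel _ hs g hg ih =>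
    obtain ⟨j, hj, rfl⟩ := hs
    simpa only [cs.inv_simple] using mul j hj g hg ih

namespace IsOrbitRank

variable {J : Set B} {x₀ : X} {Y : Set X} {rank : X → ℕ}

theorem exists_lift (h : IsOrbitRank cs J x₀ Y rank) {Z : Type*} [MulAction W Z] (z₀ : Z) :
    ∃ c : X → Z, c x₀ = z₀ ∧ ∀ x ∈ Y, x ≠ x₀ →
      ∃ i ∈ J, rank (cs.simple i • x) < rank x ∧ c (cs.simple i • x) = cs.simple i • c x := by
  classical
  let step (x : X) (rec : ∀ y, rank y < rank x → Z) : Z :=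
    if hx : ∃ i ∈ J, rank (cs.simple i • x) < rank x then
      cs.simple hx.choose • rec _ hx.choose_spec.2 else z₀
  let wf : WellFounded fun x y : X ↦ rank x < rank y := (measure rank).wf
  refine ⟨wf.fix step, ?_, fun x hx hne ↦ ?_⟩
  · rw [wf.fix_eq]
    exact dif_neg (by simp [h.rank_base])
  · have hdesc := h.exists_lt x hx hne
    refine ⟨hdesc.choose, hdesc.choose_spec.1, hdesc.choose_spec.2, ?_⟩
    rw [show wf.fix step x = cs.simple hdesc.choose • wf.fix step (cs.simple hdesc.choose • x) from
      (wf.fix_eq _ x).trans (dif_pos hdesc), smul_smul, cs.simple_mul_simple_self, one_smul]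

/-- By the braid relation, the edge from `x` to `s_j x` can be replaced by a path through points of
lower rank. -/
theorem map_simple_smul_of_peak (h : IsOrbitRank cs J x₀ Y rank) {Z : Type*} [MulAction W Z]
    {c : X → Z} {i j : B} {x : X} (hi : i ∈ J) (hj : j ∈ J) (hij : i ≠ j) (hx : x ∈ Y)
    (hix : rank (cs.simple i • x) < rank x) (hjx : rank (cs.simple j • x) ≤ rank x)
    (hci : c (cs.simple i • x) = cs.simple i • c x)
    (hc : ∀ l ∈ J, ∀ y ∈ Y, rank y < rank x → rank (cs.simple l • y) < rank x →
      c (cs.simple l • y) = cs.simple l • c y) :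
    c (cs.simple j • x) = cs.simple j • c x := by
  have hM := h.ne_zero i hi j hj
  have hpeak := h.peak i hi j hj hij x hx hix hjx
  have hY (k : ℕ) : (cs.simple j • cs.simple i • ·)^[k] x ∈ Y := by
    induction k with
    | zero => exact hx
    | succ k ih =>
      rw [Function.iterate_succ_apply']
      exact h.smul_mem j hj _ (h.smul_mem i hi _ ih)
  have hpath (k : ℕ) (hk : k ≤ M i j - 1) :
      c (cs.simple i • (cs.simple j • cs.simple i • ·)^[k] x) =
        cs.simple i • (cs.simple j • cs.simple i • ·)^[k] (c x) := by
    induction k with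
    | zero => exact hci
    | succ k ih =>
      obtain ⟨hk₁, hk₂⟩ := hpeak k hk
      have hck : c ((cs.simple j • cs.simple i • ·)^[k + 1] x) =
          (cs.simple j • cs.simple i • ·)^[k + 1] (c x) := by
        rw [Function.iterate_succ_apply'] at hk₂ ⊢
        rw [hc j hj _ (h.smul_mem i hi _ (hY k)) hk₁ hk₂, ih (by omega),
          Function.iterate_succ_apply']
      rw [← hck]
      obtain hk' | hk' := hk.lt_or_eq
      · exact hc i hi _ (hY _) hk₂ (hpeak _ hk').1
      rw [hk'] at hk₂ ⊢
      obtain hjx | hjx := hjx.lt_or_eq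
      · exact hc i hi _ (hY _) hk₂ (by rwa [simple_smul_iterate hM])
      · apply map_simple_smul_of_smul
        rw [simple_smul_iterate hM, h.smul_eq j hj x hx hjx, hci]
  have := hpath (M i j - 1) le_rfl
  rwa [simple_smul_iterate hM, simple_smul_iterate hM] at this

theorem exists_equivariant (h : IsOrbitRank cs J x₀ Y rank) {Z : Type*} [MulAction W Z] {z₀ : Z}
    (hz₀ : ∀ j ∈ J, cs.simple j • x₀ = x₀ → cs.simple j • z₀ = z₀) :
    ∃ c : X → Z, c x₀ = z₀ ∧
      ∀ j ∈ J, ∀ x ∈ Y, c (cs.simple j • x) = cs.simple j • c x := by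
  obtain ⟨c, hc₀, hc⟩ := h.exists_lift z₀
  have hdown (n : ℕ) : ∀ x ∈ Y, rank x = n → ∀ j ∈ J, rank (cs.simple j • x) ≤ rank x →
      c (cs.simple j • x) = cs.simple j • c x := by
    induction n using Nat.strong_induction_on with
    | _ n ih =>
    rintro x hx rfl j hj hjx
    obtain rfl | hne := eq_or_ne x x₀
    · have := h.smul_eq j hj x hx (le_antisymm hjx (by simp [h.rank_base]))
      rw [this, hc₀, hz₀ j hj this]
    obtain ⟨i, hi, hix, hci⟩ := hc x hx hne
    obtain rfl | hij := eq_or_ne i j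
    · exact hci
    refine h.map_simple_smul_of_peak hi hj hij hx hix hjx hci fun l hl y hy hyx hlyx ↦ ?_
    obtain hle | hle := le_total (rank (cs.simple l • y)) (rank y)
    · exact ih _ hyx y hy rfl l hl hle
    · apply map_simple_smul_of_smul
      exact ih _ hlyx _ (h.smul_mem l hl y hy) rfl l hl
        (by rwa [smul_smul, cs.simple_mul_simple_self, one_smul])
  refine ⟨c, hc₀, fun j hj x hx ↦ ?_⟩
  obtain hle | hle := le_total (rank (cs.simple j • x)) (rank x)
  · exact hdown _ x hx rfl j hj hle
  · apply map_simple_smul_of_smul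
    exact hdown _ _ (h.smul_mem j hj x hx) rfl j hj
      (by rwa [smul_smul, cs.simple_mul_simple_self, one_smul])

theorem smul_mem_of_mem_parabolic (h : IsOrbitRank cs J x₀ Y rank) {g : W}
    (hg : g ∈ parabolic cs J) : g • x₀ ∈ Y := by
  induction hg using parabolic_induction with
  | one => simpa using h.mem_base
  | mul j hj g _ ih => simpa only [mul_smul] using h.smul_mem j hj _ ih

theorem orbit_parabolic (h : IsOrbitRank cs J x₀ Y rank) : orbit (parabolic cs J) x₀ = Y := by
  apply Set.Subset.antisymm
  · rintro _ ⟨g, rfl⟩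
    exact h.smul_mem_of_mem_parabolic g.2
  · intro x hx
    induction hn : rank x using Nat.strong_induction_on generalizing x with
    | _ n ih =>
    subst hn
    obtain rfl | hne := eq_or_ne x x₀
    · exact mem_orbit_self _
    obtain ⟨i, hi, hix⟩ := h.exists_lt x hx hne
    have := mem_orbit_of_mem_orbit (⟨cs.simple i, simple_mem_parabolic hi⟩ : parabolic cs J)
      (ih _ hix (h.smul_mem i hi x hx) rfl)
    simpa only [Subgroup.mk_smul, smul_smul, cs.simple_mul_simple_self, one_smul] using this

theorem parabolic_inf_stabilizer_le (h : IsOrbitRank cs J x₀ Y rank) {K : Set B}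
    (hK : ∀ j ∈ J, cs.simple j • x₀ = x₀ → j ∈ K) :
    parabolic cs J ⊓ stabilizer W x₀ ≤ parabolic cs K := by
  obtain ⟨c, hc₀, hc⟩ := h.exists_equivariant (z₀ := ((1 : W) : W ⧸ parabolic cs K))
    fun j hj hjx ↦ by
      rw [Quotient.smul_coe, smul_eq_mul, mul_one, QuotientGroup.eq, mul_one, cs.inv_simple]
      exact simple_mem_parabolic (hK j hj hjx)
  rintro g ⟨hg, hgx⟩
  have hcg : c (g • x₀) = g • c x₀ := by
    clear hgx
    induction hg using parabolic_induction with
    | one => simp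
    | mul j hj g hg ih => rw [mul_smul, mul_smul, hc j hj _ (h.smul_mem_of_mem_parabolic hg), ih]
  rw [mem_stabilizer_iff.1 hgx, hc₀, Quotient.smul_coe, smul_eq_mul, mul_one] at hcg
  rwa [QuotientGroup.eq, inv_one, one_mul] at hcg

theorem relIndex_parabolic (h : IsOrbitRank cs J x₀ Y rank) {K : Set B}
    (hK : ∀ j, j ∈ K ↔ j ∈ J ∧ cs.simple j • x₀ = x₀) :
    (parabolic cs K).relIndex (parabolic cs J) = Y.ncard := by
  have hstab : (parabolic cs K).subgroupOf (parabolic cs J) = stabilizer (parabolic cs J) x₀ := by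
    ext g
    refine ⟨fun hg ↦ ?_, fun hg ↦ h.parabolic_inf_stabilizer_le (fun j hj hjx ↦ (hK j).2 ⟨hj, hjx⟩)
      ⟨g.2, hg⟩⟩
    refine (Subgroup.closure_le (stabilizer W x₀)).2 ?_ hg
    rintro _ ⟨j, hj, rfl⟩
    exact ((hK j).1 hj).2
  rw [Subgroup.relIndex, hstab, index_stabilizer, h.orbit_parabolic]

end IsOrbitRank

end CoxeterOrbit

/-! ### The Coxeter group of type `H₄` -/

section Reflection

variable {ι R : Type*} [Fintype ι] [CommRing R]

/-- The linear map `x ↦ x - 2 (x ⬝ᵥ r) r`, which for `r ⬝ᵥ r = 1` is the orthogonal reflection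
fixing the hyperplane `r⊥`. -/
def reflection (r : ι → R) : Module.End R (ι → R) :=
  Module.preReflection r (dotProductBilin R R ((2 : R) • r))

theorem reflection_apply (r x : ι → R) : reflection r x = x - (2 * (x ⬝ᵥ r)) • r := by
  rw [reflection, Module.preReflection_apply, dotProduct_comm]
  exact congrArg (x - · • r) (smul_dotProduct (2 : R) r x)

theorem reflection_dotProduct_reflection {r : ι → R} (hr : r ⬝ᵥ r = 1) (x y : ι → R) :
    reflection r x ⬝ᵥ reflection r y = x ⬝ᵥ y := by
  simp only [reflection_apply, sub_dotProduct, dotProduct_sub, smul_dotProduct, dotProduct_smul,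
    hr, smul_eq_mul, dotProduct_comm r]
  ring

theorem reflection_map_map {φ : Module.End R (ι → R)} (hφ : ∀ x y, φ x ⬝ᵥ φ y = x ⬝ᵥ y)
    (r x : ι → R) : reflection (φ r) (φ x) = φ (reflection r x) := by
  rw [reflection_apply, reflection_apply, hφ, map_sub, map_smul]

end Reflection

namespace CoxeterH4

open CoxeterMatrix

/-- The simple roots `½(1, -1, -1, -1)`, `(0, 1, 0, 0)`, `½(-1, -1, -1, 1)`, `½(τ⁻¹, 0, τ, -1)` of
`H₄`, where `τ = ½(1 + √5)`, reduced modulo `√5`; both `½` and `τ` reduce to `3`. -/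
def simpleRoot : Fin 4 → Fin 4 → ZMod 5 :=
  ![![3, 2, 2, 2], ![0, 1, 0, 0], ![2, 2, 2, 3], ![1, 0, 4, 2]]

theorem simpleRoot_dotProduct_self (i : Fin 4) : simpleRoot i ⬝ᵥ simpleRoot i = 1 := by
  revert i; decide

theorem isLiftable_reflection_simpleRoot : H₄.IsLiftable fun i ↦ reflection (simpleRoot i) := by
  intro i j
  refine LinearMap.pi_ext' fun l ↦ LinearMap.ext_ring ?_
  rw [LinearMap.comp_apply, LinearMap.comp_apply, Module.End.pow_apply]
  revert i j l
  decide +kernel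

/-- The reduction modulo `√5` of the geometric representation of `H₄`. -/
def rep : H₄.Group →* Module.End (ZMod 5) (Fin 4 → ZMod 5) :=
  H₄.toCoxeterSystem.lift ⟨_, isLiftable_reflection_simpleRoot⟩

instance : MulAction H₄.Group (Fin 4 → ZMod 5) := .compHom _ rep

theorem smul_def (g : H₄.Group) (x : Fin 4 → ZMod 5) : g • x = rep g x := rfl

theorem simple_smul (i : Fin 4) (x : Fin 4 → ZMod 5) :
    H₄.toCoxeterSystem.simple i • x = reflection (simpleRoot i) x := by
  rw [smul_def, rep, CoxeterSystem.lift_apply_simple]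

theorem smul_dotProduct_smul (g : H₄.Group) (x y : Fin 4 → ZMod 5) :
    (g • x) ⬝ᵥ (g • y) = x ⬝ᵥ y := by
  induction g using H₄.toCoxeterSystem.simple_induction_left generalizing x y with
  | one => simp only [one_smul]
  | mul_simple_left g i ih =>
    rw [mul_smul, mul_smul, simple_smul, simple_smul,
      reflection_dotProduct_reflection (simpleRoot_dotProduct_self i), ih]

/-- Encoding of vectors by numbers less than `625`. -/
def code (x : Fin 4 → ZMod 5) : ℕ :=
  (x 0).val * 125 + (x 1).val * 25 + (x 2).val * 5 + (x 3).val

/-- Breadth-first search for at most `n` points under the reflections in `simpleRoot i`, `k ≤ i`;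
`queue` holds the points yet to be expanded and `seen` the codes of all points found so far. -/
def explore (k : Fin 4) : ℕ → List (Fin 4 → ZMod 5) → List ℕ → List (Fin 4 → ZMod 5)
  | n + 1, x :: queue, seen =>
    let new := (((List.finRange 4).drop k).map fun i ↦ reflection (simpleRoot i) x).filter
      (code · ∉ seen)
    x :: explore k n (queue ++ new) (new.map code ++ seen)
  | _, _, _ => []

/-- `basePoint k` is a vector whose stabilizer in `⟨s_k, …, s₃⟩` is `⟨s_{k+1}, …, s₃⟩`: it is
orthogonal to `simpleRoot j` for `k < j`, but not for `j = k`. -/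
def basePoint : Fin 4 → Fin 4 → ZMod 5 :=
  ![![2, 0, 4, 1], simpleRoot 0, simpleRoot 1, simpleRoot 2]

/-- The orbit of `basePoint k` under `⟨s_k, …, s₃⟩`, in the order of breadth-first search. -/
def orbitList (k : Fin 4) : List (Fin 4 → ZMod 5) :=
  explore k 121 [basePoint k] [code (basePoint k)]

/-- The number whose digit in base `128` at the place `code x` is the position of `x` in
`orbitList k`. -/
def rankTable (k : Fin 4) : ℕ := ((orbitList k).mapIdx fun n x ↦ n * 128 ^ code x).sum

/-- The position in `orbitList k`. Reading it off a table keeps the verification by the kernel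
cheap. -/
def rank (k : Fin 4) (x : Fin 4 → ZMod 5) : ℕ := rankTable k / 128 ^ code x % 128

theorem isOrbitRank (k : Fin 4) : IsOrbitRank H₄.toCoxeterSystem (Set.Ici k) (basePoint k)
    {x | x ∈ orbitList k} (rank k) where
  ne_zero i _ j _ := by fin_cases i <;> fin_cases j <;> decide
  mem_base := by
    rw [Set.mem_ofPred_eq]
    decide +kernel +revert
  rank_base := by decide +kernel +revert
  smul_mem i hi x hx := by
    have hall : ∀ k, (orbitList k).all fun x ↦ ∀ i, k ≤ i →
        (orbitList k)[rank k (reflection (simpleRoot i) x)]? =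
          some (reflection (simpleRoot i) x) := by
      decide +kernel
    rw [simple_smul]
    exact List.mem_of_getElem? (List.all_iff_forall_prop.1 (hall k) x hx i hi)
  smul_eq i hi x hx := by
    have hall : ∀ k, (orbitList k).all fun x ↦ ∀ i, k ≤ i →
        rank k (reflection (simpleRoot i) x) = rank k x → reflection (simpleRoot i) x = x := by
      decide +kernel
    rw [simple_smul]
    exact List.all_iff_forall_prop.1 (hall k) x hx i hi
  exists_lt x hx := by
    have hall : ∀ k, (orbitList k).all fun x ↦ x ≠ basePoint k →
        ∃ i, k ≤ i ∧ rank k (reflection (simpleRoot i) x) < rank k x := by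
      decide +kernel
    simp only [simple_smul]
    exact List.all_iff_forall_prop.1 (hall k) x hx
  peak i hi j hj hij x hx := by
    have hall : ∀ k, (orbitList k).all fun x ↦ ∀ i, k ≤ i → ∀ j, k ≤ j → i ≠ j →
        rank k (reflection (simpleRoot i) x) < rank k x →
        rank k (reflection (simpleRoot j) x) ≤ rank k x → ∀ n, n < H₄ i j - 1 →
          rank k (reflection (simpleRoot i)
            ((fun y ↦ reflection (simpleRoot j) (reflection (simpleRoot i) y))^[n] x)) < rank k x ∧
          rank k ((fun y ↦ reflection (simpleRoot j) (reflection (simpleRoot i) y))^[n + 1] x) <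
            rank k x := by
      decide +kernel
    simp only [simple_smul]
    exact List.all_iff_forall_prop.1 (hall k) x hx i hi j hj hij

theorem ncard_orbitList (k : Fin 4) : {x | x ∈ orbitList k}.ncard = ![120, 12, 5, 2] k := by
  have hnodup : (orbitList k).Nodup := by
    have : ((orbitList k).map code).Nodup := by decide +kernel +revert
    exact this.of_map
  rw [← List.coe_toFinset, Set.ncard_coe_finset, List.toFinset_card_of_nodup hnodup]
  decide +kernel +revert

theorem mem_Ioi_iff (k j : Fin 4) :
    j ∈ Set.Ioi k ↔ j ∈ Set.Ici k ∧ H₄.toCoxeterSystem.simple j • basePoint k = basePoint k := by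
  simp only [simple_smul, Set.mem_Ioi, Set.mem_Ici]
  decide +kernel +revert

theorem relIndex_parabolic_Ioi (k : Fin 4) :
    (parabolic H₄.toCoxeterSystem (Set.Ioi k)).relIndex (parabolic H₄.toCoxeterSystem (Set.Ici k)) =
      ![120, 12, 5, 2] k := by
  rw [(isOrbitRank k).relIndex_parabolic (mem_Ioi_iff k), ncard_orbitList]

theorem parabolic_Ici_zero : parabolic H₄.toCoxeterSystem (Set.Ici 0) = ⊤ := by
  have : Set.Ici (0 : Fin 4) = Set.univ := Set.Ici_bot
  rw [parabolic, this, Set.image_univ, H₄.toCoxeterSystem.subgroup_closure_range_simple]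

theorem parabolic_Ioi_three : parabolic H₄.toCoxeterSystem (Set.Ioi 3) = ⊥ := by
  have : Set.Ioi (3 : Fin 4) = ∅ := Set.Ioi_top
  rw [parabolic, this, Set.image_empty, Subgroup.closure_empty]

theorem card_parabolic_Ici (k : Fin 4) : Nat.card (parabolic H₄.toCoxeterSystem (Set.Ici k)) =
    Nat.card (parabolic H₄.toCoxeterSystem (Set.Ioi k)) * ![120, 12, 5, 2] k := by
  rw [← relIndex_parabolic_Ioi, ← Subgroup.relIndex_bot_left, ← Subgroup.relIndex_bot_left,
    Subgroup.relIndex_mul_relIndex _ _ _ bot_le (parabolic_mono Set.Ioi_subset_Ici_self)]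

theorem card_group : Nat.card H₄.Group = 14400 := by
  have h₀ : Set.Ioi (0 : Fin 4) = Set.Ici 1 := rfl
  have h₁ : Set.Ioi (1 : Fin 4) = Set.Ici 2 := rfl
  have h₂ : Set.Ioi (2 : Fin 4) = Set.Ici 3 := rfl
  rw [← Subgroup.card_top, ← parabolic_Ici_zero, card_parabolic_Ici, h₀, card_parabolic_Ici, h₁,
    card_parabolic_Ici, h₂, card_parabolic_Ici, parabolic_Ioi_three, Subgroup.card_bot]
  rfl

instance : Finite H₄.Group := Nat.finite_of_card_ne_zero (by rw [card_group]; norm_num)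

theorem faithfulSMul : FaithfulSMul H₄.Group (Fin 4 → ZMod 5) := by
  refine faithfulSMul_iff.2 fun g hg ↦ ?_
  have hdesc (k : Fin 4) (h : g ∈ parabolic H₄.toCoxeterSystem (Set.Ici k)) :
      g ∈ parabolic H₄.toCoxeterSystem (Set.Ioi k) :=
    (isOrbitRank k).parabolic_inf_stabilizer_le (fun j hj hjx ↦ (mem_Ioi_iff k j).2 ⟨hj, hjx⟩)
      ⟨h, hg _⟩
  have hbot := hdesc 3 <| hdesc 2 <| hdesc 1 <| hdesc 0 (parabolic_Ici_zero ▸ Subgroup.mem_top g)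
  rwa [parabolic_Ioi_three, Subgroup.mem_bot] at hbot

theorem exists_smul_basePoint_eq {r : Fin 4 → ZMod 5} (hr : r ⬝ᵥ r = 1) :
    ∃ g : H₄.Group, g • basePoint 0 = r := by
  have hall : ∀ r : Fin 4 → ZMod 5, r ⬝ᵥ r = 1 → (orbitList 0)[rank 0 r]? = some r := by
    decide +kernel
  have hmem : r ∈ orbit (parabolic H₄.toCoxeterSystem (Set.Ici 0)) (basePoint 0) :=
    (isOrbitRank 0).orbit_parabolic ▸ List.mem_of_getElem? (hall r hr)
  obtain ⟨g, hg⟩ := hmem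
  exact ⟨g, hg⟩

theorem exists_smul_eq_reflection {r : Fin 4 → ZMod 5} (hr : r ⬝ᵥ r = 1) :
    ∃ g : H₄.Group, ∀ x, g • x = reflection r x := by
  obtain ⟨g, rfl⟩ := exists_smul_basePoint_eq hr
  obtain ⟨h, hh⟩ := exists_smul_basePoint_eq (simpleRoot_dotProduct_self 0)
  let w := g * h⁻¹
  have hw : g • basePoint 0 = rep w (simpleRoot 0) := by
    rw [← smul_def, ← hh, smul_smul, inv_mul_cancel_right]
  refine ⟨w * H₄.toCoxeterSystem.simple 0 * w⁻¹, fun x ↦ ?_⟩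
  rw [hw, mul_smul, mul_smul, simple_smul, smul_def, ← reflection_map_map (smul_dotProduct_smul w),
    ← smul_def w (w⁻¹ • x), smul_inv_smul]

theorem range_toPermHom_klein_le :
    (toPermHom KleinSemidirect (Fin 4 → ZMod 5)).range ≤
      (toPermHom H₄.Group (Fin 4 → ZMod 5)).range := by
  obtain ⟨s, hs⟩ := exists_smul_eq_reflection (r := ![1, 0, 0, 0]) (by decide)
  obtain ⟨a, ha⟩ := exists_smul_eq_reflection (r := ![2, 2, 3, 3]) (by decide)
  obtain ⟨b, hb⟩ := exists_smul_eq_reflection (r := ![2, 3, 2, 3]) (by decide)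
  obtain ⟨c, hc⟩ := exists_smul_eq_reflection (r := ![2, 3, 3, 2]) (by decide)
  have hs' (x : Fin 4 → ZMod 5) : s • x = KleinSemidirect.signChange 0 • x := by
    rw [hs, KleinSemidirect.signChange_zero_smul]
    decide +kernel +revert
  have hbc (x : Fin 4 → ZMod 5) :
      (b * c) • x = (⟨1, klein 1⟩ : KleinSemidirect) • x := by
    rw [mul_smul, hb, hc, KleinSemidirect.mk_klein_one_smul]
    decide +kernel +revert
  have hac (x : Fin 4 → ZMod 5) :
      (a * c) • x = (⟨1, klein 2⟩ : KleinSemidirect) • x := by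
    rw [mul_smul, ha, hc, KleinSemidirect.mk_klein_two_smul]
    decide +kernel +revert
  exact KleinSemidirect.range_toPermHom_le ⟨s, Perm.ext hs'⟩ ⟨b * c, Perm.ext hbc⟩
    ⟨a * c, Perm.ext hac⟩

theorem nonempty_sylow_mulEquiv (P : Sylow 2 H₄.Group) : Nonempty (P ≃* KleinSemidirect) := by
  have := faithfulSMul
  have := KleinSemidirect.faithfulSMul (R := ZMod 5) (by decide)
  exact nonempty_sylow_mulEquiv_of_range_le (m := 225) toPerm_injective toPerm_injective
    range_toPermHom_klein_le KleinSemidirect.isPGroup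
    (by rw [card_group, KleinSemidirect.card]; norm_num) (by decide) P

end CoxeterH4

/-! ### The group `𝔖₂ ⋉ (Q₈ × Q₈)` -/

noncomputable section

namespace Quat

attribute [simps] i j k

end Quat

namespace Q8

theorem star_eq_inv (c : Q8) : star (c.1 : ℍ[ℝ]) = (c.1⁻¹ : ℍ[ℝ]ˣ) := by
  refine (Units.inv_eq_of_mul_eq_one_left ?_).symm
  rcases c.2 with h | h | h | h | h | h | h | h <;> rw [h] <;> ext <;> simp

/-- The element `i` of the quaternion group. -/
def i : Q8 := ⟨⟨Quat.i, -Quat.i, by simp [Quat.i_mul_i], by simp [Quat.i_mul_i]⟩,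
  Or.inr (Or.inr (Or.inl rfl))⟩

/-- The element `j` of the quaternion group. -/
def j : Q8 := ⟨⟨Quat.j, -Quat.j, by simp [Quat.j_mul_j], by simp [Quat.j_mul_j]⟩,
  Or.inr (Or.inr (Or.inr (Or.inr (Or.inl rfl))))⟩

theorem eq_one_or_eq_negOne {c : Q8} (hi : (c.1 : ℍ[ℝ]) * Quat.i = Quat.i * c.1)
    (hj : (c.1 : ℍ[ℝ]) * Quat.j = Quat.j * c.1) : c = 1 ∨ c = negOne := by
  have hcI : (c.1 : ℍ[ℝ]).imI = 0 :=
    self_eq_neg.1 (by simpa using congrArg QuaternionAlgebra.imK hj)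
  have hcJ : (c.1 : ℍ[ℝ]).imJ = 0 :=
    neg_eq_self.1 (by simpa using congrArg QuaternionAlgebra.imK hi)
  have hcK : (c.1 : ℍ[ℝ]).imK = 0 :=
    self_eq_neg.1 (by simpa using congrArg QuaternionAlgebra.imJ hi)
  rcases c.2 with h | h | h | h | h | h | h | h
  · exact .inl (Subtype.ext (Units.ext h))
  · exact .inr (Subtype.ext (Units.ext h))
  all_goals simp [h] at hcI hcJ hcK

theorem eq_top_of_mem {S : Subgroup Q8} (hi : i ∈ S) (hj : j ∈ S) : S = ⊤ := by
  refine (Subgroup.eq_top_iff' S).2 fun c ↦ ?_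
  have hpos {a : Q8} (ha : a ∈ S) (h : (c.1 : ℍ[ℝ]) = a.1) : c ∈ S := by
    rwa [show c = a from Subtype.ext (Units.ext h)]
  have hneg {a : Q8} (ha : a ∈ S) (h : (c.1 : ℍ[ℝ]) = -a.1) : c ∈ S :=
    hpos (S.mul_mem (S.mul_mem hi hi) ha) (by simp [h, i, Quat.i_mul_i])
  have hk {a : ℍ[ℝ]} (h : a = Quat.k) : a = (i * j).1 := by rw [h, ← Quat.i_mul_j]; rfl
  rcases c.2 with h | h | h | h | h | h | h | h
  · exact hpos S.one_mem h
  · exact hneg S.one_mem h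
  · exact hpos hi h
  · exact hneg hi h
  · exact hpos hj h
  · exact hneg hj h
  · exact hpos (S.mul_mem hi hj) (h.trans (hk rfl))
  · exact hneg (S.mul_mem hi hj) (h.trans (congrArg _ (hk rfl)))

end Q8

theorem perm_fin_two_eq_one_or_eq_swap (σ : Perm (Fin 2)) : σ = 1 ∨ σ = swap 0 1 := by
  revert σ; decide

namespace Q8Wreath

theorem eq_top_of_mem {S : Subgroup Q8Wreath}
    (hi : SemidirectProduct.inl (Pi.mulSingle 0 Q8.i) ∈ S)
    (hj : SemidirectProduct.inl (Pi.mulSingle 0 Q8.j) ∈ S)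
    (hswap : SemidirectProduct.inr (swap 0 1) ∈ S) : S = ⊤ := by
  have hfirst (a : Q8) : SemidirectProduct.inl (Pi.mulSingle 0 a) ∈ S := by
    have := Q8.eq_top_of_mem
      (S := S.comap (SemidirectProduct.inl.comp (MonoidHom.mulSingle (fun _ ↦ Q8) 0))) hi hj
    exact (Subgroup.eq_top_iff' _).1 this a
  have hsecond (a : Q8) : SemidirectProduct.inl (Pi.mulSingle 1 a) ∈ S := by
    have : (Pi.mulSingle 1 a : Fin 2 → Q8) =
        mulAutArrow (swap 0 1 : Perm (Fin 2)) (Pi.mulSingle 0 a) := by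
      funext l; fin_cases l <;> rfl
    rw [this, SemidirectProduct.inl_aut, map_inv]
    exact S.mul_mem (S.mul_mem hswap (hfirst a)) (S.inv_mem hswap)
  refine (Subgroup.eq_top_iff' S).2 fun ⟨c, σ⟩ ↦ ?_
  have hc : c = Pi.mulSingle 0 (c 0) * Pi.mulSingle 1 (c 1) := by
    funext l; fin_cases l <;> simp
  rw [SemidirectProduct.mk_eq_inl_mul_inr, hc, map_mul]
  refine S.mul_mem (S.mul_mem (hfirst _) (hsecond _)) ?_
  obtain rfl | rfl := perm_fin_two_eq_one_or_eq_swap σ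
  · exact map_one (SemidirectProduct.inr : _ →* Q8Wreath) ▸ S.one_mem
  · exact hswap

/-- The action of `Q₈ × Q₈` on the quaternions by `x ↦ a x b⁻¹`. -/
def pairAction : (Fin 2 → Q8) →* Perm ℍ[ℝ] :=
  MonoidHom.toHomPerm
    { toFun c x := (c 0).1 * x * ((c 1).1⁻¹ : ℍ[ℝ]ˣ)
      map_one' := by funext x; simp; rfl
      map_mul' c d := by
        funext x
        change _ = ((c 0).1 : ℍ[ℝ]) * ((d 0).1 * x * ((d 1).1⁻¹ : ℍ[ℝ]ˣ)) * ((c 1).1⁻¹ : ℍ[ℝ]ˣ)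
        simp [mul_assoc] }

theorem pairAction_apply (c : Fin 2 → Q8) (x : ℍ[ℝ]) :
    pairAction c x = (c 0).1 * x * ((c 1).1⁻¹ : ℍ[ℝ]ˣ) := rfl

/-- The action of `𝔖₂` on the quaternions by conjugation. -/
def swapAction : Perm (Fin 2) →* Perm ℍ[ℝ] where
  toFun σ := if σ = 1 then 1 else star_involutive.toPerm
  map_one' := if_pos rfl
  map_mul' σ τ := by
    have hsq : (star_involutive.toPerm * star_involutive.toPerm : Perm ℍ[ℝ]) = 1 :=
      Perm.ext star_star
    have hne : (swap 0 1 : Perm (Fin 2)) ≠ 1 := by decide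
    obtain rfl | rfl := perm_fin_two_eq_one_or_eq_swap σ <;>
      obtain rfl | rfl := perm_fin_two_eq_one_or_eq_swap τ <;> simp [hne, hsq]

theorem swapAction_swap_apply (x : ℍ[ℝ]) : swapAction (swap 0 1) x = star x := by
  have hne : (swap 0 1 : Perm (Fin 2)) ≠ 1 := by decide
  exact congrArg (fun τ : Perm ℍ[ℝ] ↦ τ x) (if_neg (t := (1 : Perm ℍ[ℝ])) hne)

/-- The action of `𝔖₂ ⋉ (Q₈ × Q₈)` on the quaternions. -/
def action : Q8Wreath →* Perm ℍ[ℝ] :=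
  SemidirectProduct.lift pairAction swapAction fun σ ↦ by
    obtain rfl | rfl := perm_fin_two_eq_one_or_eq_swap σ
    · simp only [map_one]
      rfl
    · ext1 c
      refine eq_mul_inv_of_mul_eq (Perm.ext fun x ↦ ?_)
      change pairAction (fun l ↦ c ((swap 0 1 : Perm (Fin 2))⁻¹ l)) (swapAction (swap 0 1) x) =
        swapAction (swap 0 1) (pairAction c x)
      simp [swapAction_swap_apply, pairAction_apply, Q8.star_eq_inv, mul_assoc]

theorem action_apply (w : Q8Wreath) (x : ℍ[ℝ]) :
    action w x = (w.left 0).1 * swapAction w.right x * ((w.left 1).1⁻¹ : ℍ[ℝ]ˣ) := rfl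

theorem left_zero_eq_left_one_of_action_eq_one {w : Q8Wreath} (hw : action w = 1) :
    w.left 0 = w.left 1 := by
  have hone : action w 1 = 1 := by rw [hw, Perm.one_apply]
  have hstar : swapAction w.right 1 = 1 := by
    obtain h | h := perm_fin_two_eq_one_or_eq_swap w.right <;> rw [h]
    · rw [swapAction.map_one, Perm.one_apply]
    · rw [swapAction_swap_apply, star_one]
  rw [action_apply, hstar, mul_one, Units.mul_inv_eq_one] at hone
  exact Subtype.ext (Units.ext hone)

/-- Otherwise `star`, an anti-automorphism of a noncommutative ring, would be inner. -/
theorem right_eq_one_of_action_eq_one {w : Q8Wreath} (hw : action w = 1) : w.right = 1 := by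
  refine (perm_fin_two_eq_one_or_eq_swap w.right).resolve_right fun hswap ↦ ?_
  have hconj (x : ℍ[ℝ]) : (w.left 0).1 * star x = x * (w.left 0).1 := by
    rw [← Units.mul_inv_eq_iff_eq_mul]
    nth_rw 2 [left_zero_eq_left_one_of_action_eq_one hw]
    rw [← swapAction_swap_apply, ← hswap, ← action_apply, hw, Perm.one_apply]
  have hcomm : star (Quat.i * Quat.j) = star (Quat.j * Quat.i) := by
    rw [← Units.mul_right_inj (w.left 0).1, hconj, mul_assoc, ← hconj, ← mul_assoc, ← hconj,
      mul_assoc, star_mul Quat.j]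
  rw [star_inj, Quat.i_mul_j, Quat.j_mul_i] at hcomm
  have := congrArg QuaternionAlgebra.imK hcomm
  norm_num at this

theorem ker_action : action.ker = negOneNegOne := by
  apply le_antisymm
  · intro w hw
    have hright := right_eq_one_of_action_eq_one hw
    have hcomm (x : ℍ[ℝ]) : ((w.left 1).1 : ℍ[ℝ]) * x = x * (w.left 1).1 := by
      have : action w x = x := by rw [MonoidHom.mem_ker.1 hw, Perm.one_apply]
      rwa [action_apply, hright, map_one, Perm.one_apply, Units.mul_inv_eq_iff_eq_mul,
        left_zero_eq_left_one_of_action_eq_one hw] at this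
    have hleft : w = SemidirectProduct.inl fun _ ↦ w.left 1 := by
      refine SemidirectProduct.ext (funext fun l ↦ ?_) hright
      fin_cases l
      · exact left_zero_eq_left_one_of_action_eq_one hw
      · rfl
    rw [hleft]
    obtain h | h := Q8.eq_one_or_eq_negOne (hcomm Quat.i) (hcomm Quat.j) <;> rw [h]
    · exact one_mem _
    · exact Subgroup.mem_zpowers _
  · rw [negOneNegOne, Subgroup.zpowers_le, MonoidHom.mem_ker]
    ext1 x
    simp [action_apply, Q8.negOne]

/-- The action of `𝔖₂ ⋉ (Q₈ × Q₈)` on the coordinates of the quaternions. -/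
def coordAction : Q8Wreath →* Perm (Fin 4 → ℝ) :=
  (Quaternion.equivTuple ℝ).permCongrHom.toMonoidHom.comp action

theorem ker_coordAction : coordAction.ker = negOneNegOne := by
  rw [← ker_action]
  exact MonoidHom.ker_comp_of_injective _ _ (MulEquiv.injective _)

theorem coordAction_eq_toPermHom {w : Q8Wreath} {k : KleinSemidirect}
    (h : ∀ x : ℍ[ℝ], Quaternion.equivTuple ℝ (action w x) = k • Quaternion.equivTuple ℝ x) :
    coordAction w = toPermHom KleinSemidirect (Fin 4 → ℝ) k :=
  Perm.ext fun y ↦ (h ((Quaternion.equivTuple ℝ).symm y)).trans <| by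
    rw [Equiv.apply_symm_apply, toPermHom_apply, toPerm_apply]

theorem coordAction_inl_i : coordAction (SemidirectProduct.inl (Pi.mulSingle 0 Q8.i)) =
    toPermHom KleinSemidirect _ ⟨![-1, 1, -1, 1], klein 1⟩ :=
  coordAction_eq_toPermHom fun x ↦ by
    rw [KleinSemidirect.mk_klein_one_smul]
    simp [action_apply, Q8.i]

theorem coordAction_inl_j : coordAction (SemidirectProduct.inl (Pi.mulSingle 0 Q8.j)) =
    toPermHom KleinSemidirect _ ⟨![-1, 1, 1, -1], klein 2⟩ :=
  coordAction_eq_toPermHom fun x ↦ by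
    rw [KleinSemidirect.mk_klein_two_smul]
    simp [action_apply, Q8.j]

theorem coordAction_swap : coordAction (SemidirectProduct.inr (swap 0 1)) =
    toPermHom KleinSemidirect _ ⟨![1, -1, -1, -1], klein 0⟩ :=
  coordAction_eq_toPermHom fun x ↦ by
    rw [KleinSemidirect.mk_klein_zero_smul]
    simp [action_apply, swapAction_swap_apply]

theorem coordAction_negOne_swap :
    coordAction (SemidirectProduct.inl ![Q8.negOne, 1] * SemidirectProduct.inr (swap 0 1)) =
      toPermHom KleinSemidirect _ (KleinSemidirect.signChange 0) :=
  coordAction_eq_toPermHom fun x ↦ by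
    rw [KleinSemidirect.signChange_zero_smul]
    simp [action_apply, swapAction_swap_apply, Q8.negOne]

theorem range_coordAction :
    coordAction.range = (toPermHom KleinSemidirect (Fin 4 → ℝ)).range := by
  apply le_antisymm
  · rw [MonoidHom.range_eq_map, Subgroup.map_le_iff_le_comap, top_le_iff]
    exact eq_top_of_mem ⟨_, coordAction_inl_i.symm⟩ ⟨_, coordAction_inl_j.symm⟩
      ⟨_, coordAction_swap.symm⟩
  · exact KleinSemidirect.range_toPermHom_le ⟨_, coordAction_negOne_swap⟩ ⟨_, coordAction_inl_i⟩
      ⟨_, coordAction_inl_j⟩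

theorem nonempty_quotient_mulEquiv :
    Nonempty ((Q8Wreath ⧸ Q8Wreath.negOneNegOne) ≃* KleinSemidirect) := by
  have := KleinSemidirect.faithfulSMul (R := ℝ) (by norm_num)
  exact ⟨(QuotientGroup.quotientMulEquivOfEq ker_coordAction.symm).trans <|
    (QuotientGroup.quotientKerEquivRange coordAction).trans <|
    (MulEquiv.subgroupCongr range_coordAction).trans
    (MonoidHom.ofInjective (f := toPermHom KleinSemidirect (Fin 4 → ℝ)) toPerm_injective).symm⟩

end Q8Wreath

end

theorem mainTheorem11 :
    Nonempty ((Q8Wreath ⧸ Q8Wreath.negOneNegOne) ≃* KleinSemidirect) ∧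
    Finite CoxeterMatrix.H₄.Group ∧
    ∀ (P : Sylow 2 CoxeterMatrix.H₄.Group) (Q : Sylow 2 (alternatingGroup (Fin 8))),
      Nonempty (P ≃* Q) ∧ Nonempty (P ≃* KleinSemidirect) ∧ Nonempty (Q ≃* KleinSemidirect) := by
  refine ⟨Q8Wreath.nonempty_quotient_mulEquiv, inferInstance, fun P Q ↦ ?_⟩
  obtain ⟨e⟩ := CoxeterH4.nonempty_sylow_mulEquiv P
  obtain ⟨e'⟩ := nonempty_sylow_alternatingGroup_mulEquiv (Fintype.card_fin 8) Q
  exact ⟨⟨e.trans e'.symm⟩, ⟨e⟩, ⟨e'⟩⟩
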